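/- Let $G$ be a finite weighted multigraph with vertex set $V$, without loops (multiple edges are allowed), all of whose edge weights are strictly positive. Let $L=(\ell_{ij})$ be its Laplacian matrix: for $i\ne j$, $-\ell_{ij}$ is the sum of the weights of all edges between $i$ and $j$, and $\ell_{ii}=-\sum_{j\neq i}\ell_{ij}$. Let $\alpha>0$, let $Q=(q_{ij})=(I+\alpha L)^{-1}$, and let $$d_{ij}=\tfrac12\,(q_{ii}+q_{jj}-q_{ij}-q_{ji})$$ be the forest distance between the vertices $i$ and $j$. Let $G_\alpha$ be the weighted multigraph obtained from $G$ by multiplying all edge weights by $\alpha$. A spanning rooted forest of $G_\alpha$ is an acyclic spanning subgraph of $G_\alpha$ with exactly one vertex marked as a root in each of its components (trees); its weight $\varepsilon(F)$ is the product of the weights (in $G_\alpha$) of its edges. Such a forest is an unsuccessful connection from $u$ to $v$ if $u$ is a root and $v$ does not belong to the tree rooted at $u$. Let $i,j\in V$ and consider the following random experiment: choose one of $i$, $j$ with probability $1/2$ each and, independently, choose a spanning rooted forest $F$ of $G_\alpha$ with probability $\varepsilon(F)/\sum_{F'}\varepsilon(F')$, where the sum is over all spanning rooted forests $F'$ of $G_\alpha$.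 Then $d_{ij}$ is equal to the probability that $F$ is an unsuccessful connection from the chosen vertex to the other vertex of the pair $(i,j)$. -/

import Mathlib

/-- A loopless weighted multigraph with vertex type `V` and edge type `E`: every edge has an
unordered pair of distinct end vertices and a strictly positive weight.  Several edges may have
the same ends. -/
structure WeightedMultigraph (V E : Type*) where
  /-- the unordered pair of ends of an edge -/
  ends : E → Sym2 V
  /-- the weight of an edge -/
  weight : E → ℝ
  not_isDiag_ends : ∀ e, ¬ (ends e).IsDiag
  weight_pos : ∀ e, 0 < weight e

namespace WeightedMultigraph

section Basic

variable {V E : Type*}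

/-- The weighted multigraph `G_α` obtained from `G` by multiplying all weights by `α > 0`. -/
def scale (G : WeightedMultigraph V E) (α : ℝ) (hα : 0 < α) : WeightedMultigraph V E where
  ends := G.ends
  weight e := α * G.weight e
  not_isDiag_ends := G.not_isDiag_ends
  weight_pos e := mul_pos hα (G.weight_pos e)

/-- The simple graph on `V` in which two vertices are adjacent when some edge in `F` joins them.
It has the same connected components as the spanning subgraph of `G` with edge set `F`. -/
def support (G : WeightedMultigraph V E) (F : Finset E) : SimpleGraph V :=
  SimpleGraph.fromEdgeSet {s | ∃ e ∈ F, G.ends e = s}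

/-- The spanning subgraph of `G` with edge set `F` has no cycle: it has no two parallel edges
(a cycle of length two), and no cycle of length at least three. -/
def IsAcyclic (G : WeightedMultigraph V E) (F : Finset E) : Prop :=
  Set.InjOn G.ends (F : Set E) ∧ (G.support F).IsAcyclic

/-- A spanning rooted forest of `G`: an acyclic set of edges (all vertices of `G` are vertices of
the forest), and a set of vertices, the roots, that has exactly one member in each component. -/
@[ext]
structure SpanningRootedForest (G : WeightedMultigraph V E) where
  edges : Finset E
  roots : Finset V
  isAcyclic : G.IsAcyclic edges
  existsUnique_root : ∀ c : (G.support edges).ConnectedComponent,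
    ∃! r, r ∈ roots ∧ (G.support edges).connectedComponentMk r = c

namespace SpanningRootedForest

variable {G : WeightedMultigraph V E}

/-- The weight of a forest: the product of the weights of its edges. -/
def weight (F : G.SpanningRootedForest) : ℝ := ∏ e ∈ F.edges, G.weight e

/-- `F` is an unsuccessful connection from `i` to `j`: `i` is a root, and `j` does not belong to
the tree (component) of `i`. -/
def IsUnsuccessful (F : G.SpanningRootedForest) (i j : V) : Prop :=
  i ∈ F.roots ∧ ¬ (G.support F.edges).Reachable i j

lemma weight_pos (F : G.SpanningRootedForest) : 0 < F.weight :=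
  Finset.prod_pos fun e _ => G.weight_pos e

noncomputable instance [Fintype V] [Fintype E] : Fintype G.SpanningRootedForest :=
  Fintype.ofInjective (fun F => (F.edges, F.roots)) fun F F' h => by
    simp only [Prod.mk.injEq] at h
    exact SpanningRootedForest.ext h.1 h.2

/-- The edgeless forest, in which every vertex is a root. -/
instance [Fintype V] : Nonempty G.SpanningRootedForest := by
  have h : G.support ∅ = ⊥ := by simp [support]
  refine ⟨⟨∅, Finset.univ, ⟨by simp, by rw [h]; exact SimpleGraph.isAcyclic_bot⟩, ?_⟩⟩
  rw [h]
  intro c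
  induction c using SimpleGraph.ConnectedComponent.ind with
  | _ v =>
    refine ⟨v, ⟨Finset.mem_univ v, rfl⟩, fun r hr => ?_⟩
    simpa using hr.2

end SpanningRootedForest

/-- The random spanning rooted forest of `G`: a forest is chosen with probability its weight
divided by the sum of the weights of all spanning rooted forests. -/
noncomputable def randomForest [Fintype V] [Fintype E] (G : WeightedMultigraph V E) :
    PMF G.SpanningRootedForest :=
  PMF.ofFintype
    (fun F => ENNReal.ofReal (F.weight / ∑ F' : G.SpanningRootedForest, F'.weight)) <| by
    have h : 0 < ∑ F' : G.SpanningRootedForest, F'.weight :=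
      Finset.sum_pos (fun F _ => F.weight_pos) Finset.univ_nonempty
    rw [← ENNReal.ofReal_sum_of_nonneg fun F _ => div_nonneg F.weight_pos.le h.le,
      ← Finset.sum_div, div_self h.ne', ENNReal.ofReal_one]

/-- The law of the random connection of `i` and `j` in `G`.  An outcome `(u, v, F)` consists of
the vertex `u` chosen among `i` and `j` by a fair coin, the remaining vertex `v`, and a random
spanning rooted forest `F` chosen independently of the coin. -/
noncomputable def randomConnection [Fintype V] [Fintype E] (G : WeightedMultigraph V E)
    (i j : V) : PMF (V × V × G.SpanningRootedForest) :=
  (PMF.uniformOfFintype Bool).bind fun b =>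
    G.randomForest.map fun F => if b then (i, j, F) else (j, i, F)

/-- The probability that an unsuccessful connection between `i` and `j` is chosen, that is, that
the random forest is an unsuccessful connection from the chosen vertex to the remaining one. -/
noncomputable def probUnsuccessful [Fintype V] [Fintype E] (G : WeightedMultigraph V E)
    (i j : V) : ℝ :=
  ((G.randomConnection i j).toOuterMeasure {ω | ω.2.2.IsUnsuccessful ω.1 ω.2.1}).toReal

end Basic

section Matrices

variable {V E : Type*} [Fintype V] [DecidableEq V] [Fintype E]

/-- The total weight of the edges between `i` and `j`. -/
def edgeWeight (G : WeightedMultigraph V E) (i j : V) : ℝ :=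
  ∑ e with G.ends e = s(i, j), G.weight e

/-- The Laplacian matrix of `G`. -/
def laplacian (G : WeightedMultigraph V E) : Matrix V V ℝ :=
  Matrix.of fun i j =>
    if i = j then ∑ k ∈ Finset.univ.erase i, G.edgeWeight i k else - G.edgeWeight i j

/-- The inverse that defines the relative forest accessibilities exists. -/
lemma isUnit_one_add_smul_laplacian (G : WeightedMultigraph V E) {α : ℝ} (hα : 0 < α) :
    IsUnit (1 + α • G.laplacian) := by
  rw [Matrix.isUnit_iff_isUnit_det, isUnit_iff_ne_zero]
  have hw : ∀ i j, 0 ≤ G.edgeWeight i j := fun i j =>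
    Finset.sum_nonneg fun e _ => (G.weight_pos e).le
  refine det_ne_zero_of_sum_row_lt_diag fun i => ?_
  have h1 : ∀ k ∈ Finset.univ.erase i,
      ‖(1 + α • G.laplacian) i k‖ = α * G.edgeWeight i k := by
    intro k hk
    have hk' : i ≠ k := (Finset.ne_of_mem_erase hk).symm
    simp [laplacian, hk', abs_of_nonneg, hα.le, hw]
  rw [Finset.sum_congr rfl h1, ← Finset.mul_sum]
  have h2 : (1 + α • G.laplacian) i i = 1 + α * ∑ k ∈ Finset.univ.erase i, G.edgeWeight i k := by
    simp [laplacian]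
  rw [h2, Real.norm_eq_abs]
  exact lt_of_lt_of_le (by linarith) (le_abs_self _)

/-- The matrix `Q_α = (I + α L)⁻¹` of relative forest accessibilities. -/
noncomputable def accessibility (G : WeightedMultigraph V E) (α : ℝ) : Matrix V V ℝ :=
  (1 + α • G.laplacian)⁻¹

/-- The forest distance between `i` and `j` with parameter `α`. -/
noncomputable def forestDist (G : WeightedMultigraph V E) (α : ℝ) (i j : V) : ℝ :=
  1 / 2 * (G.accessibility α i i + G.accessibility α j j
    - G.accessibility α i j - G.accessibility α j i)

end Matrices

end WeightedMultigraph

/-!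
For `φ : V → ℝ`, the average of `φ ∘ F.root` over the random spanning rooted forest `F` solves
`(1 + L) *ᵥ ψ = φ`. Indeed, the forests in which `j` is not a root arise, each exactly once, from
those in which `j` is a root by hanging the tree rooted at `j` on another tree along an edge at `j`.
Fix a forest in which `j` is a root, let `c x` be the weights of these edges and `a x` the values of
`φ` at the roots of the trees to which they lead. The row of `j` in the equation, summed over that
forest and those obtained from it, is the required one up to `∑ x, ∑ y, c x * c y * (a x - a y)`,
which vanishes by antisymmetry.

Hence the entry of `(1 + L)⁻¹` at `(k, i)` is the probability that `k` belongs to a tree rooted at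
`i`, and the difference of the entries at `(i, i)` and `(j, i)` is the probability of an
unsuccessful connection from `i` to `j`.
-/

lemma sum_sum_mul_mul_sub_eq_zero {ι R : Type*} [CommRing R] (s : Finset ι) (c a : ι → R) :
    ∑ x ∈ s, ∑ y ∈ s, c x * (c y * (a x - a y)) = 0 := by
  simp only [mul_sub, Finset.sum_sub_distrib]
  rw [sub_eq_zero, Finset.sum_comm]
  exact Finset.sum_congr rfl fun x _ => Finset.sum_congr rfl fun y _ => by ring

section Reachability

open SimpleGraph

variable {V : Type*} {H : SimpleGraph V}

lemma reachable_sup_edge_iff {a b u v : V} :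
    (H ⊔ edge a b).Reachable u v ↔ H.Reachable u v ∨ (H.Reachable u a ∧ H.Reachable b v) ∨
      (H.Reachable u b ∧ H.Reachable a v) := by
  constructor
  · rintro ⟨p⟩
    induction p with
    | nil => exact Or.inl (Reachable.refl _)
    | cons h p ih =>
      rcases h with h | h
      · have := h.reachable
        exact ih.imp this.trans (Or.imp (And.imp_left this.trans) (And.imp_left this.trans))
      · obtain ⟨⟨rfl, rfl⟩ | ⟨rfl, rfl⟩, -⟩ := (edge_adj ..).1 h
        all_goals simp only [Reachable.refl, true_and]; tauto
  · have hle : H ≤ H ⊔ edge a b := le_sup_left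
    have hab : (H ⊔ edge a b).Reachable a b := by
      by_cases hne : a = b
      · rw [hne]
      · exact Adj.reachable (Or.inr (by simp [edge_adj, hne]))
    rintro (h | ⟨h, h'⟩ | ⟨h, h'⟩)
    · exact h.mono hle
    · exact (h.mono hle).trans (hab.trans (h'.mono hle))
    · exact (h.mono hle).trans (hab.symm.trans (h'.mono hle))

lemma exists_adj_reachable_deleteEdges {u v : V} (h : H.Reachable u v) (hne : u ≠ v) :
    ∃ m, H.Adj u m ∧ (H.deleteEdges {s(u, m)}).Reachable m v := by
  classical
  obtain ⟨p, hp⟩ := h.exists_isPath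
  cases p with
  | nil => exact absurd rfl hne
  | @cons _ m _ hadj q =>
    rw [Walk.cons_isPath_iff] at hp
    exact ⟨m, hadj, reachable_deleteEdges_iff_exists_walk.2
      ⟨q, fun hq => hp.2 (q.fst_mem_support_of_mem_edges hq)⟩⟩

end Reachability

namespace WeightedMultigraph

variable {V E : Type*} {G : WeightedMultigraph V E}

section Support

variable {S : Finset E} {e : E} {u v : V}

lemma support_mono {T : Finset E} (h : S ⊆ T) : G.support S ≤ G.support T :=
  SimpleGraph.fromEdgeSet_mono fun _ ⟨e, he, hs⟩ => ⟨e, h he, hs⟩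

lemma IsAcyclic.mono {T : Finset E} (h : G.IsAcyclic T) (hST : S ⊆ T) : G.IsAcyclic S :=
  ⟨h.1.mono hST, h.2.anti (support_mono hST)⟩

lemma support_adj_of_mem (he : e ∈ S) (hends : G.ends e = s(u, v)) : (G.support S).Adj u v := by
  refine (SimpleGraph.fromEdgeSet_adj _).2 ⟨⟨e, he, hends⟩, fun h => G.not_isDiag_ends e ?_⟩
  rw [hends]
  exact Sym2.mk_isDiag_iff.2 h

variable [DecidableEq E]

lemma support_insert (hends : G.ends e = s(u, v)) :
    G.support (insert e S) = G.support S ⊔ SimpleGraph.edge u v := by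
  rw [support, support, SimpleGraph.edge, ← SimpleGraph.fromEdgeSet_union]
  congr 1
  ext s
  simp [hends, eq_comm]

lemma support_erase (he : e ∈ S) (hS : Set.InjOn G.ends (S : Set E)) :
    G.support (S.erase e) = (G.support S).deleteEdges {G.ends e} := by
  rw [support, support, SimpleGraph.deleteEdges, ← SimpleGraph.fromEdgeSet_sdiff]
  congr 1
  ext s
  simp only [Finset.mem_erase, Set.mem_sdiff, Set.mem_ofPred_eq, Set.mem_singleton_iff]
  constructor
  · rintro ⟨f, ⟨hne, hf⟩, rfl⟩
    exact ⟨⟨f, hf, rfl⟩, fun h => hne (hS hf he h)⟩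
  · rintro ⟨⟨f, hf, rfl⟩, hne⟩
    exact ⟨f, ⟨fun h => hne (congrArg G.ends h), hf⟩, rfl⟩

lemma IsAcyclic.insert (h : G.IsAcyclic S) (hends : G.ends e = s(u, v))
    (huv : ¬ (G.support S).Reachable u v) : G.IsAcyclic (insert e S) := by
  have hparallel : ∀ f ∈ S, G.ends f ≠ s(u, v) := fun f hf hfe =>
    huv (support_adj_of_mem hf hfe).reachable
  constructor
  · rw [Finset.coe_insert, Set.injOn_insert fun he => hparallel e he hends]
    exact ⟨h.1, fun ⟨f, hf, hfe⟩ => hparallel f hf (hfe.trans hends)⟩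
  · rw [support_insert hends]
    exact h.2.sup_edge_of_not_reachable huv

lemma IsAcyclic.not_reachable_erase (h : G.IsAcyclic S) (he : e ∈ S) (hends : G.ends e = s(u, v)) :
    ¬ (G.support (S.erase e)).Reachable u v := by
  rw [support_erase he h.1, hends]
  exact SimpleGraph.isBridge_iff.1
    (SimpleGraph.isAcyclic_iff_forall_adj_isBridge.1 h.2 (support_adj_of_mem he hends))

end Support

namespace SpanningRootedForest

section Root

variable (F : G.SpanningRootedForest) {u v r : V}

/-- The root of the tree of `F` that contains `v`. -/
noncomputable def root (v : V) : V :=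
  (F.existsUnique_root ((G.support F.edges).connectedComponentMk v)).choose

lemma root_eq_iff : F.root v = r ↔ r ∈ F.roots ∧ (G.support F.edges).Reachable r v := by
  have h := F.existsUnique_root ((G.support F.edges).connectedComponentMk v)
  rw [← SimpleGraph.ConnectedComponent.eq]
  exact ⟨fun hr => hr ▸ h.choose_spec.1, fun hr => h.unique h.choose_spec.1 hr⟩

lemma root_mem (v : V) : F.root v ∈ F.roots := (F.root_eq_iff.1 rfl).1

lemma reachable_root (v : V) : (G.support F.edges).Reachable (F.root v) v :=
  (F.root_eq_iff.1 rfl).2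

variable {F}

lemma root_eq_self (hr : r ∈ F.roots) : F.root r = r :=
  F.root_eq_iff.2 ⟨hr, SimpleGraph.Reachable.refl r⟩

lemma reachable_iff_root_eq (hr : r ∈ F.roots) :
    (G.support F.edges).Reachable r v ↔ F.root v = r := by
  rw [root_eq_iff, and_iff_right hr]

lemma root_eq_root_of_mem {e : E} (he : e ∈ F.edges) (hends : G.ends e = s(u, v)) :
    F.root u = F.root v :=
  F.root_eq_iff.2 ⟨F.root_mem v,
    (F.reachable_root v).trans (support_adj_of_mem he hends).symm.reachable⟩

/-- The spanning rooted forest with edge set `S` and root set `R`, given the map `ρ` that sends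
every vertex to the root of its tree. -/
def ofRoot {S : Finset E} (hS : G.IsAcyclic S) (R : Finset V) (ρ : V → V)
    (hρ : ∀ v r, ρ v = r ↔ r ∈ R ∧ (G.support S).Reachable r v) : G.SpanningRootedForest where
  edges := S
  roots := R
  isAcyclic := hS
  existsUnique_root c := by
    induction c using SimpleGraph.ConnectedComponent.ind with
    | _ v =>
      simp only [SimpleGraph.ConnectedComponent.eq, ← hρ]
      exact existsUnique_eq'

lemma root_ofRoot {S : Finset E} (hS : G.IsAcyclic S) (R : Finset V) (ρ : V → V)
    (hρ : ∀ v r, ρ v = r ↔ r ∈ R ∧ (G.support S).Reachable r v) : (ofRoot hS R ρ hρ).root = ρ :=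
  funext fun v => (root_eq_iff _).2 ((hρ v _).1 rfl)

end Root

/-- An edge of `G` that joins `j` to a vertex `m` outside the tree of `F` with root `j`, encoded
as the pair of `m` and the edge. -/
abbrev Exit (F : G.SpanningRootedForest) (j : V) : Type _ :=
  {x : V × E // G.ends x.2 = s(j, x.1) ∧ F.root x.1 ≠ j}

variable {F F' : G.SpanningRootedForest} {j : V}

lemma exit_notMem_edges (hj : j ∈ F.roots) (x : F.Exit j) : x.1.2 ∉ F.edges := fun h =>
  x.2.2 ((root_eq_root_of_mem h x.2.1).symm.trans (root_eq_self hj))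

variable [DecidableEq E]

lemma reachable_root_erase (hj : j ∈ F.roots) {m v : V} {e : E} (he : e ∈ F.edges)
    (hends : G.ends e = s(j, m)) (hv : F.root v ≠ j) :
    (G.support (F.edges.erase e)).Reachable (F.root v) v := by
  have hle := support_mono (G := G) (Finset.erase_subset e F.edges)
  have hreach := F.reachable_root v
  rw [← Finset.insert_erase he, support_insert hends, reachable_sup_edge_iff] at hreach
  rcases hreach with h | ⟨h, -⟩ | ⟨-, h⟩
  · exact h
  · have := (reachable_iff_root_eq (F.root_mem v)).1 (h.mono hle)
    exact absurd (this.symm.trans (root_eq_self hj)) hv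
  · exact absurd ((reachable_iff_root_eq hj).1 (h.mono hle)) hv

lemma not_reachable_erase_of_mem_roots {T : G.SpanningRootedForest} {m : V} {e : E}
    (he : e ∈ T.edges) (hends : G.ends e = s(j, m))
    (hm : (G.support (T.edges.erase e)).Reachable m (T.root j)) {r : V} (hr : r ∈ T.roots) :
    ¬ (G.support (T.edges.erase e)).Reachable r j := fun hrj => by
  have hroot : T.root j = r :=
    T.root_eq_iff.2 ⟨hr, hrj.mono (support_mono (Finset.erase_subset e T.edges))⟩
  rw [hroot] at hm
  exact T.isAcyclic.not_reachable_erase he hends (hm.trans hrj).symm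

lemma exists_edge_reachable_root {T : G.SpanningRootedForest} (hj : j ∉ T.roots) :
    ∃ (m : V) (e : E), e ∈ T.edges ∧ G.ends e = s(j, m) ∧
      (G.support (T.edges.erase e)).Reachable m (T.root j) := by
  obtain ⟨m, hadj, hm⟩ := exists_adj_reachable_deleteEdges (T.reachable_root j).symm
    fun h => hj (h ▸ T.root_mem j)
  obtain ⟨⟨e, he, hends⟩, -⟩ := (SimpleGraph.fromEdgeSet_adj _).1 hadj
  rw [← hends, ← support_erase he T.isAcyclic.1] at hm
  exact ⟨m, e, he, hends, hm⟩

variable [DecidableEq V]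

/-- The forest obtained from `F` by hanging the tree with root `j` on another tree along an edge
at `j`. The vertices of both trees then have the root of the latter. -/
noncomputable def attach (F : G.SpanningRootedForest) (hj : j ∈ F.roots) (x : F.Exit j) :
    G.SpanningRootedForest :=
  ofRoot (S := insert x.1.2 F.edges)
    (F.isAcyclic.insert x.2.1 fun h => x.2.2 ((reachable_iff_root_eq hj).1 h))
    (F.roots.erase j) (fun v => if F.root v = j then F.root x.1.1 else F.root v) fun v r => by
      obtain ⟨⟨m, e⟩, hends, hm : F.root m ≠ j⟩ := x
      rw [support_insert hends, reachable_sup_edge_iff, Finset.mem_erase]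
      by_cases hr : r ∈ F.roots
      · simp only [reachable_iff_root_eq hj, reachable_iff_root_eq hr, root_eq_self hj]
        grind
      · grind [root_mem]

section Attach

variable (hj : j ∈ F.roots) (x : F.Exit j)

@[simp]
lemma edges_attach : (F.attach hj x).edges = insert x.1.2 F.edges := rfl

@[simp]
lemma roots_attach : (F.attach hj x).roots = F.roots.erase j := rfl

lemma root_attach (v : V) :
    (F.attach hj x).root v = if F.root v = j then F.root x.1.1 else F.root v :=
  congrFun (root_ofRoot ..) v

lemma weight_attach : (F.attach hj x).weight = G.weight x.1.2 * F.weight :=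
  Finset.prod_insert (exit_notMem_edges hj x)

end Attach

lemma exit_edge_eq_of_attach_eq {hj : j ∈ F.roots} {hj' : j ∈ F'.roots} {x : F.Exit j}
    {x' : F'.Exit j} (h : F.attach hj x = F'.attach hj' x') : x.1.2 = x'.1.2 := by
  by_contra hne
  have hroots : F.roots = F'.roots := by
    rw [← Finset.insert_erase hj, ← roots_attach hj x, h, roots_attach, Finset.insert_erase hj']
  have hedges : insert x.1.2 F.edges = insert x'.1.2 F'.edges := congrArg edges h
  have hmem : ∀ f, f = x.1.2 ∨ f ∈ F.edges ↔ f = x'.1.2 ∨ f ∈ F'.edges := by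
    simpa only [Finset.mem_insert] using Finset.ext_iff.1 hedges
  have hx : x.1.2 ∈ F'.edges := ((hmem _).1 (Or.inl rfl)).resolve_left hne
  have hx' : x'.1.2 ∈ F.edges := ((hmem _).2 (Or.inl rfl)).resolve_left (Ne.symm hne)
  have hsub : F.edges.erase x'.1.2 ⊆ F'.edges := fun f hf =>
    ((hmem f).1 (Or.inr (Finset.mem_of_mem_erase hf))).resolve_left (Finset.ne_of_mem_erase hf)
  -- The path of `F` from the far end of `x` to its root avoids `x'`, so it is a path of `F'`.
  have hroot : F'.root x.1.1 = F.root x.1.1 :=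
    F'.root_eq_iff.2 ⟨hroots ▸ F.root_mem _,
      (reachable_root_erase hj hx' x'.2.1 x.2.2).mono (support_mono hsub)⟩
  have hroot' : F'.root x.1.1 = j := (root_eq_root_of_mem hx x.2.1).symm.trans (root_eq_self hj')
  exact x.2.2 (hroot.symm.trans hroot')

lemma attach_inj {hj : j ∈ F.roots} {hj' : j ∈ F'.roots} {x : F.Exit j} {x' : F'.Exit j}
    (h : F.attach hj x = F'.attach hj' x') : F = F' ∧ x.1 = x'.1 := by
  have he : x.1.2 = x'.1.2 := exit_edge_eq_of_attach_eq h
  have hm : x.1.1 = x'.1.1 := Sym2.congr_right.1 (x.2.1.symm.trans (he ▸ x'.2.1))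
  refine ⟨SpanningRootedForest.ext ?_ ?_, Prod.ext hm he⟩
  · rw [← Finset.erase_insert (exit_notMem_edges hj x), ← edges_attach hj x, h, edges_attach, he,
      Finset.erase_insert (exit_notMem_edges hj' x')]
  · rw [← Finset.insert_erase hj, ← roots_attach hj x, h, roots_attach, Finset.insert_erase hj']

open scoped Classical in
/-- The forest obtained from `T` by deleting the edge `e` from `j` to its neighbour `m` on the path
to the root of `j`, and making `j` a root. It is the inverse of `attach`. -/
noncomputable def detach (T : G.SpanningRootedForest) {m : V} {e : E} (he : e ∈ T.edges)
    (hends : G.ends e = s(j, m)) (hm : (G.support (T.edges.erase e)).Reachable m (T.root j)) :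
    G.SpanningRootedForest :=
  ofRoot (T.isAcyclic.mono (Finset.erase_subset e T.edges)) (insert j T.roots)
    (fun v => if (G.support (T.edges.erase e)).Reachable j v then j else T.root v) fun v r => by
      have hroots := fun hr => not_reachable_erase_of_mem_roots (r := r) he hends hm hr
      rw [Finset.mem_insert]
      split_ifs with h
      · constructor
        · rintro rfl
          exact ⟨Or.inl rfl, h⟩
        · rintro ⟨hr, hrv⟩
          exact (hr.resolve_right fun hr => hroots hr (hrv.trans h.symm)).symm
      · have hsupport : G.support T.edges =
            G.support (T.edges.erase e) ⊔ SimpleGraph.edge j m := by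
          rw [← support_insert hends, Finset.insert_erase he]
        rw [root_eq_iff, hsupport, reachable_sup_edge_iff]
        constructor
        · rintro ⟨hr, hrv | ⟨hrj, -⟩ | ⟨-, hjv⟩⟩
          exacts [⟨Or.inr hr, hrv⟩, absurd hrj (hroots hr), absurd hjv h]
        · rintro ⟨rfl | hr, hrv⟩
          exacts [absurd hrv h, ⟨hr, Or.inl hrv⟩]

lemma exists_attach_eq {T : G.SpanningRootedForest} (hj : j ∉ T.roots) :
    ∃ (F : G.SpanningRootedForest) (hj : j ∈ F.roots) (x : F.Exit j), F.attach hj x = T := by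
  obtain ⟨m, e, he, hends, hm⟩ := exists_edge_reachable_root hj
  have hjF : j ∈ (T.detach he hends hm).roots := Finset.mem_insert_self j T.roots
  have hmF : (T.detach he hends hm).root m ≠ j := fun h =>
    T.isAcyclic.not_reachable_erase he hends ((reachable_iff_root_eq hjF).2 h)
  exact ⟨T.detach he hends hm, hjF, ⟨(m, e), hends, hmF⟩,
    SpanningRootedForest.ext (Finset.insert_erase he) (Finset.erase_insert hj)⟩

end SpanningRootedForest

open scoped Matrix

section Laplacian

variable {V E : Type*} [Fintype V] [DecidableEq V] [Fintype E] {G : WeightedMultigraph V E}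

lemma laplacian_scale (G : WeightedMultigraph V E) {α : ℝ} (hα : 0 < α) :
    (G.scale α hα).laplacian = α • G.laplacian := by
  have hw : ∀ i k, (G.scale α hα).edgeWeight i k = α * G.edgeWeight i k := fun i k =>
    (Finset.mul_sum ..).symm
  ext i k
  simp only [laplacian, hw, Matrix.of_apply, Matrix.smul_apply, smul_eq_mul, ← Finset.mul_sum,
    mul_ite, mul_neg]

lemma laplacian_mulVec_apply (G : WeightedMultigraph V E) (ψ : V → ℝ) (j : V) :
    (G.laplacian *ᵥ ψ) j = ∑ k, G.edgeWeight j k * (ψ j - ψ k) := by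
  have hoff : ∀ k ∈ Finset.univ.erase j, G.laplacian j k * ψ k = -(G.edgeWeight j k * ψ k) :=
    fun k hk => by simp [laplacian, (Finset.ne_of_mem_erase hk).symm]
  have hdiag : G.laplacian j j = ∑ k ∈ Finset.univ.erase j, G.edgeWeight j k := by
    simp [laplacian]
  rw [Matrix.mulVec, dotProduct, ← Finset.add_sum_erase _ _ (Finset.mem_univ j),
    ← Finset.add_sum_erase _ _ (Finset.mem_univ j), Finset.sum_congr rfl hoff, hdiag, sub_self,
    mul_zero, zero_add, Finset.sum_mul, ← Finset.sum_add_distrib]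
  exact Finset.sum_congr rfl fun k _ => by ring

lemma sum_edgeWeight_mul_eq_sum_exit (F : G.SpanningRootedForest) (j : V) {f : V → ℝ}
    (hf : ∀ k, F.root k = j → f k = 0) :
    ∑ k, G.edgeWeight j k * f k = ∑ x : F.Exit j, G.weight x.1.2 * f x.1.1 := by
  rw [← Finset.sum_subtype (Finset.univ.filter fun x : V × E =>
      G.ends x.2 = s(j, x.1) ∧ F.root x.1 ≠ j) (by simp) fun x => G.weight x.2 * f x.1,
    Finset.sum_filter, Fintype.sum_prod_type]
  refine Finset.sum_congr rfl fun k _ => ?_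
  by_cases hk : F.root k = j
  · simp [hk, hf k hk]
  · simp [hk, edgeWeight, Finset.sum_mul, Finset.sum_filter]

lemma one_add_laplacian_mulVec_apply (F : G.SpanningRootedForest) {j : V} {ψ : V → ℝ}
    (hψ : ∀ k, F.root k = j → ψ k = ψ j) :
    ((1 + G.laplacian) *ᵥ ψ) j =
      ψ j + ∑ x : F.Exit j, G.weight x.1.2 * (ψ j - ψ x.1.1) := by
  rw [Matrix.add_mulVec, Matrix.one_mulVec, Pi.add_apply, laplacian_mulVec_apply,
    sum_edgeWeight_mul_eq_sum_exit F j fun k hk => sub_eq_zero.2 (hψ k hk).symm]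

lemma one_add_laplacian_mulVec_comp_root_apply {F : G.SpanningRootedForest} {j : V}
    (hj : j ∈ F.roots) (φ : V → ℝ) :
    ((1 + G.laplacian) *ᵥ (φ ∘ F.root)) j =
      φ j + ∑ x : F.Exit j, G.weight x.1.2 * (φ j - φ (F.root x.1.1)) := by
  have hroot : F.root j = j := SpanningRootedForest.root_eq_self hj
  rw [one_add_laplacian_mulVec_apply F fun k hk => by simp [hk, hroot]]
  simp [hroot]

end Laplacian

section MatrixForest

variable {V E : Type*} [Fintype V] [Fintype E] {G : WeightedMultigraph V E}

lemma sum_weight_pos (G : WeightedMultigraph V E) : 0 < ∑ F : G.SpanningRootedForest, F.weight :=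
  Finset.sum_pos (fun F _ => F.weight_pos) Finset.univ_nonempty

variable [DecidableEq V]

section Attach

variable [DecidableEq E]

lemma sum_eq_sum_add_sum_attach {M : Type*} [AddCommMonoid M] (f : G.SpanningRootedForest → M)
    (j : V) :
    ∑ F, f F = ∑ F : {F : G.SpanningRootedForest // j ∈ F.roots},
      (f F.1 + ∑ x : F.1.Exit j, f (F.1.attach F.2 x)) := by
  let attachTo (y : Σ F : {F : G.SpanningRootedForest // j ∈ F.roots}, F.1.Exit j) :
      {F : G.SpanningRootedForest // j ∉ F.roots} :=
    ⟨y.1.1.attach y.1.2 y.2, Finset.notMem_erase j _⟩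
  have hbij : attachTo.Bijective := by
    constructor
    · rintro ⟨⟨F, hj⟩, x⟩ ⟨⟨F', hj'⟩, x'⟩ h
      have hattach : F.attach hj x = F'.attach hj' x' := congrArg Subtype.val h
      obtain ⟨rfl, hx⟩ := SpanningRootedForest.attach_inj hattach
      obtain rfl : x = x' := Subtype.ext hx
      rfl
    · rintro ⟨T, hT⟩
      obtain ⟨F, hj, x, rfl⟩ := SpanningRootedForest.exists_attach_eq hT
      exact ⟨⟨⟨F, hj⟩, x⟩, rfl⟩
  rw [← Fintype.sum_subtype_add_sum_subtype (fun F : G.SpanningRootedForest => j ∈ F.roots),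
    Finset.sum_add_distrib, ← (Equiv.ofBijective _ hbij).sum_comp, Fintype.sum_sigma]
  rfl

lemma one_add_laplacian_mulVec_comp_root_attach_apply {F : G.SpanningRootedForest} {j : V}
    (hj : j ∈ F.roots) (x : F.Exit j) (φ : V → ℝ) :
    ((1 + G.laplacian) *ᵥ (φ ∘ (F.attach hj x).root)) j =
      φ (F.root x.1.1) +
        ∑ y : F.Exit j, G.weight y.1.2 * (φ (F.root x.1.1) - φ (F.root y.1.1)) := by
  have hroot : F.root j = j := SpanningRootedForest.root_eq_self hj
  have hattach : ∀ v, (F.attach hj x).root v = if F.root v = j then F.root x.1.1 else F.root v :=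
    SpanningRootedForest.root_attach hj x
  rw [one_add_laplacian_mulVec_apply F fun k hk => by simp [hattach, hk, hroot]]
  simp only [Function.comp_apply, hattach, hroot, if_true]
  exact congrArg _ (Finset.sum_congr rfl fun y _ => by rw [if_neg y.2.2])

lemma weight_mul_one_add_laplacian_mulVec_add_sum_attach {F : G.SpanningRootedForest} {j : V}
    (hj : j ∈ F.roots) (φ : V → ℝ) :
    F.weight * ((1 + G.laplacian) *ᵥ (φ ∘ F.root)) j +
        ∑ x, (F.attach hj x).weight * ((1 + G.laplacian) *ᵥ (φ ∘ (F.attach hj x).root)) j =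
      (F.weight + ∑ x, (F.attach hj x).weight) * φ j := by
  have hcancel := sum_sum_mul_mul_sub_eq_zero Finset.univ
    (fun x : F.Exit j => G.weight x.1.2) fun x => φ (F.root x.1.1)
  have hsum : ∑ x : F.Exit j, G.weight x.1.2 * (φ (F.root x.1.1) +
        ∑ y : F.Exit j, G.weight y.1.2 * (φ (F.root x.1.1) - φ (F.root y.1.1))) =
      ∑ x : F.Exit j, G.weight x.1.2 * φ (F.root x.1.1) := by
    simpa only [mul_add, Finset.mul_sum, Finset.sum_add_distrib, add_eq_left] using hcancel
  simp only [one_add_laplacian_mulVec_comp_root_apply hj,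
    one_add_laplacian_mulVec_comp_root_attach_apply hj, SpanningRootedForest.weight_attach,
    mul_right_comm _ F.weight, ← Finset.sum_mul, hsum]
  simp only [mul_sub, Finset.sum_sub_distrib, ← Finset.sum_mul]
  ring

end Attach

lemma one_add_laplacian_mulVec_sum (G : WeightedMultigraph V E) (φ : V → ℝ) :
    (1 + G.laplacian) *ᵥ (∑ F : G.SpanningRootedForest, F.weight • (φ ∘ F.root)) =
      (∑ F : G.SpanningRootedForest, F.weight) • φ := by
  classical
  ext j
  simp only [Matrix.mulVec_sum, Matrix.mulVec_smul, Finset.sum_apply, Pi.smul_apply, smul_eq_mul]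
  rw [sum_eq_sum_add_sum_attach _ j, sum_eq_sum_add_sum_attach _ j, Finset.sum_mul]
  exact Finset.sum_congr rfl fun F _ =>
    weight_mul_one_add_laplacian_mulVec_add_sum_attach F.2 φ

lemma inv_one_add_laplacian_mulVec (G : WeightedMultigraph V E) (φ : V → ℝ) :
    (1 + G.laplacian)⁻¹ *ᵥ φ = (∑ F : G.SpanningRootedForest, F.weight)⁻¹ •
      ∑ F : G.SpanningRootedForest, F.weight • (φ ∘ F.root) := by
  have hunit : IsUnit (1 + G.laplacian) := by
    simpa only [one_smul] using G.isUnit_one_add_smul_laplacian one_pos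
  have hinv : (1 + G.laplacian)⁻¹ * (1 + G.laplacian) = 1 :=
    Matrix.nonsing_inv_mul _ ((Matrix.isUnit_iff_isUnit_det _).1 hunit)
  rw [eq_inv_smul_iff₀ G.sum_weight_pos.ne', ← Matrix.mulVec_smul, ← one_add_laplacian_mulVec_sum,
    Matrix.mulVec_mulVec, hinv, Matrix.one_mulVec]

end MatrixForest

section Probability

variable {V E : Type*} [Fintype V] [Fintype E]

/-- The probability that the random spanning rooted forest of `G` belongs to `s`, as a real
number. -/
noncomputable def forestProb (G : WeightedMultigraph V E) (s : Set G.SpanningRootedForest) : ℝ :=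
  (G.randomForest.toOuterMeasure s).toReal

variable (G : WeightedMultigraph V E)

lemma forestProb_eq_sum_div_sum (s : Set G.SpanningRootedForest) :
    G.forestProb s = (∑ F, s.indicator SpanningRootedForest.weight F) /
      ∑ F : G.SpanningRootedForest, F.weight := by
  have hmass : ∀ F, (s.indicator G.randomForest F).toReal =
      s.indicator SpanningRootedForest.weight F / ∑ F' : G.SpanningRootedForest, F'.weight := by
    intro F
    by_cases hF : F ∈ s
    · simp [hF, randomForest, F.weight_pos.le, G.sum_weight_pos.le, div_nonneg]
    · simp [hF]
  have htop : ∀ F ∈ Finset.univ, s.indicator G.randomForest F ≠ ⊤ := fun F _ =>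
    ne_top_of_le_ne_top (PMF.apply_ne_top _ F) (Set.indicator_le_self _ _ F)
  rw [forestProb, PMF.toOuterMeasure_apply_fintype, ENNReal.toReal_sum htop, Finset.sum_div]
  exact Finset.sum_congr rfl fun F _ => hmass F

lemma forestProb_add_of_disjoint {s t : Set G.SpanningRootedForest} (h : Disjoint s t) :
    G.forestProb (s ∪ t) = G.forestProb s + G.forestProb t := by
  simp only [forestProb_eq_sum_div_sum, Set.indicator_union_of_disjoint h, Finset.sum_add_distrib,
    add_div]

lemma forestProb_isUnsuccessful (i j : V) :
    G.forestProb {F | F.IsUnsuccessful i j} =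
      G.forestProb {F | F.root i = i} - G.forestProb {F | F.root j = i} := by
  have hdisj : Disjoint {F : G.SpanningRootedForest | F.IsUnsuccessful i j} {F | F.root j = i} :=
    Set.disjoint_left.2 fun F hF hj => hF.2 (F.root_eq_iff.1 hj).2
  have hunion : {F : G.SpanningRootedForest | F.root i = i} =
      {F | F.IsUnsuccessful i j} ∪ {F | F.root j = i} := by
    ext F
    simp only [Set.mem_ofPred_eq, Set.mem_union, SpanningRootedForest.root_eq_iff,
      SpanningRootedForest.IsUnsuccessful, SimpleGraph.Reachable.refl]
    tauto
  rw [hunion, forestProb_add_of_disjoint G hdisj, add_sub_cancel_right]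

lemma probUnsuccessful_eq_half_mul_add (i j : V) :
    G.probUnsuccessful i j = 1 / 2 *
      (G.forestProb {F | F.IsUnsuccessful i j} + G.forestProb {F | F.IsUnsuccessful j i}) := by
  have hfin : ∀ s : Set G.SpanningRootedForest, G.randomForest.toOuterMeasure s ≠ ⊤ := fun s =>
    ne_top_of_le_ne_top G.randomForest.tsum_coe_ne_top <| by
      rw [PMF.toOuterMeasure_apply]
      exact ENNReal.tsum_le_tsum fun F => Set.indicator_le_self _ _ F
  rw [probUnsuccessful, randomConnection, PMF.toOuterMeasure_bind_apply, tsum_bool,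
    PMF.toOuterMeasure_map_apply, PMF.toOuterMeasure_map_apply,
    ENNReal.toReal_add (ENNReal.mul_ne_top (PMF.apply_ne_top _ _) (hfin _))
      (ENNReal.mul_ne_top (PMF.apply_ne_top _ _) (hfin _)),
    ENNReal.toReal_mul, ENNReal.toReal_mul]
  simp only [PMF.uniformOfFintype_apply, Fintype.card_bool, ENNReal.toReal_inv,
    Set.preimage_ofPred_eq, Nat.cast_ofNat, ENNReal.toReal_ofNat, Bool.false_eq_true, if_true,
    if_false, forestProb]
  ring

variable [DecidableEq V]

lemma inv_one_add_laplacian_apply (k i : V) :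
    (1 + G.laplacian)⁻¹ k i = G.forestProb {F | F.root k = i} := by
  rw [← Matrix.col_apply (1 + G.laplacian)⁻¹ i k, ← Matrix.mulVec_single_one,
    inv_one_add_laplacian_mulVec, forestProb_eq_sum_div_sum, div_eq_inv_mul]
  simp [Set.indicator_apply, Pi.single_apply]

lemma accessibility_eq_forestProb {α : ℝ} (hα : 0 < α) (k i : V) :
    G.accessibility α k i = (G.scale α hα).forestProb {F | F.root k = i} := by
  rw [accessibility, ← laplacian_scale G hα, inv_one_add_laplacian_apply]

end Probability

end WeightedMultigraph

theorem proposition5 {V E : Type*} [Fintype V] [DecidableEq V] [Fintype E]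
    (G : WeightedMultigraph V E) (α : ℝ) (hα : 0 < α) (i j : V) :
    G.forestDist α i j = (G.scale α hα).probUnsuccessful i j := by
  simp only [WeightedMultigraph.forestDist, WeightedMultigraph.accessibility_eq_forestProb G hα,
    WeightedMultigraph.probUnsuccessful_eq_half_mul_add,
    WeightedMultigraph.forestProb_isUnsuccessful]
  ring
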